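/- Fix $p\in(0,1/2)$ and let $D_{\mathrm{KL}}(p\|1-p)=p\log\frac{p}{1-p}+(1-p)\log\frac{1-p}{p}$ be the Kullback–Leibler divergence between the $\mathrm{Bern}(p)$ and $\mathrm{Bern}(1-p)$ distributions (natural logarithms). A variable-length algorithm on $n$ bits has no direct access to its input $\mathbf x\in\{0,1\}^n$. At each step it adaptively (and possibly at random), on the basis of all earlier queries and responses, either queries one of the bits or stops and outputs a bit. Each query of $x_i$ returns, independently of the past, the value $x_i$ with probability $1-p$ and the wrong value $1-x_i$ with probability $p$. Let $M$ be the total number of queries made. The worst-case error probability of an algorithm for a function $f:\{0,1\}^n\to\{0,1\}$ is the maximum over $\mathbf x\in\{0,1\}^n$ of the probability that, on input $\mathbf x$, it does not output $f(\mathbf x)$. Let $(\delta_n)_{n\ge 0}$ be positive reals with $\delta_n\to 0$ as $n\to\infty$. Then there is a real sequence $\varepsilon_n\to0$ such that, for all sufficiently large $n$ and for $f$ equal to either the $\mathsf{OR}$ or the $\mathsf{AND}$ function of $n$ bits, the following hold. 1. (Necessity) Every variable-length algorithm with $$\mathbb E[M\mid\mathbf x]\le(1-\varepsilon_n)\,\frac{n\log\frac1{\delta_n}}{D_{\mathrm{KL}}(p\|1-p)}\quad\text{for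 all }\mathbf x\in\{0,1\}^n$$ has worst-case error probability for $f$ greater than $\delta_n$. 2. (Sufficiency) There is a variable-length algorithm with worst-case error probability for $f$ at most $\delta_n$ and $$\mathbb E[M\mid\mathbf x]\le(1+\varepsilon_n)\,\frac{n\log\frac1{\delta_n}}{D_{\mathrm{KL}}(p\|1-p)}\quad\text{for all }\mathbf x\in\{0,1\}^n.$$ -/

import Mathlib

open Filter Topology

namespace NoisyQuery

noncomputable section

/-- The `OR` function of `n` Boolean variables. -/
def orFn {n : ℕ} (x : Fin n → Bool) : Bool := decide (∃ i, x i = true)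

/-- The `AND` function of `n` Boolean variables. -/
def andFn {n : ℕ} (x : Fin n → Bool) : Bool := decide (∀ i, x i = true)

/-- The Kullback-Leibler divergence `D_KL(p ‖ 1 - p)` between the Bernoulli distributions with
parameters `p` and `1 - p`, in nats. -/
def klBern (p : unitInterval) : ℝ :=
  (InformationTheory.klDiv (ProbabilityTheory.bernoulliMeasure true false p)
    (ProbabilityTheory.bernoulliMeasure true false (unitInterval.symm p))).toReal

/-- A noisy reading of the bit `b`: the output of a binary symmetric channel with crossover
probability `p` and input `b`. The wrong value `!b` is returned with probability `p`. -/
def noisyRead (p : unitInterval) (b : Bool) : PMF Bool :=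
  PMF.ofFintype (fun y => if y = b then ENNReal.ofReal (1 - p) else ENNReal.ofReal p) (by
    have h : ENNReal.ofReal (1 - p) + ENNReal.ofReal p = 1 := by
      rw [← ENNReal.ofReal_add (sub_nonneg.2 p.2.2) p.2.1]
      simp
    cases b <;> simp [h, add_comm (ENNReal.ofReal (p : ℝ))])

/-- What the agent can do next: query one of the `n` bits, or stop and output a value. -/
inductive Action (n : ℕ) : Type
  | query (i : Fin n) : Action n
  | output (b : Bool) : Action n

/-- The queries made so far with the responses received, the most recent one first. -/
abbrev Transcript (n : ℕ) : Type := List (Fin n × Bool)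

/-- A variable-length algorithm: an adaptive and possibly randomized rule that selects, on the
basis of all previous queries and responses, which bit to query next, or stops with an output.
It has no access to the input except through the responses. -/
abbrev Algorithm (n : ℕ) : Type := Transcript n → PMF (Action n)

/-- The transcript so far, with the output if the algorithm has stopped. -/
abbrev Config (n : ℕ) : Type := Transcript n × Option Bool

/-- One step of the algorithm `A` on the input `x`. Given the transcript, each response is an
independent noisy reading of the queried bit. -/
def step {n : ℕ} (p : unitInterval) (A : Algorithm n) (x : Fin n → Bool) :
    Config n → PMF (Config n)
  | (h, some b) => PMF.pure (h, some b)
  | (h, none) => (A h).bind fun a =>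
      match a with
      | Action.query i => (noisyRead p (x i)).map fun y => ((i, y) :: h, none)
      | Action.output b => PMF.pure (h, some b)

/-- The distribution of the configuration after `t` steps of `A` on the input `x`. -/
def run {n : ℕ} (p : unitInterval) (A : Algorithm n) (x : Fin n → Bool) : ℕ → PMF (Config n)
  | 0 => PMF.pure ([], none)
  | t + 1 => (run p A x t).bind (step p A x)

/-- `E[M | x]`, where `M` is the total number of queries made by `A` on the input `x`: the number
of queries made in the first `t` steps increases to `M`, so its expectation increases to
`E[M | x]`. The value is `∞` if `A` fails to stop with positive probability. -/
def expectedQueries {n : ℕ} (p : unitInterval) (A : Algorithm n) (x : Fin n → Bool) : ENNReal :=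
  ⨆ t : ℕ, ∑' c : Config n, run p A x t c * (c.1.length : ENNReal)

/-- The probability that `A` on the input `x` does not stop with the output `f x`: the
probability that it has not done so within `t` steps decreases to it. Never stopping counts as an
error. -/
def errorProb {n : ℕ} (p : unitInterval) (A : Algorithm n) (f : (Fin n → Bool) → Bool)
    (x : Fin n → Bool) : ENNReal :=
  ⨅ t : ℕ, (run p A x t).toOuterMeasure {c | c.2 ≠ some (f x)}

/-- The worst-case error probability of `A` as an algorithm that computes `f`. -/
def worstCaseError {n : ℕ} (p : unitInterval) (A : Algorithm n) (f : (Fin n → Bool) → Bool) :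
    ENNReal :=
  ⨆ x : Fin n → Bool, errorProb p A f x

end

end NoisyQuery

/-! ### The divergence in closed form, and `OR` and `AND` as one function. -/

namespace NoisyQuery
open scoped ENNReal

/-! Write `L = log ((1 - p) / p)` and `l = log (1 / δ)`. Then the divergence is `D = (1 - 2p) L`: a
correct response moves the log-likelihood ratio by `L` in favour of the true bit, a wrong one by `L`
against it. Up to exchanging the two bit values, `OR` and `AND` are the same function `existsBit z`,
which detects an occurrence of `z`.

Necessity. On the input with no `z`, flipping any single bit changes the answer, so for every `i`
the output `!z` must be likely on this input and have probability at most `δ` on the flipped one. By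
a change of measure this costs about `l / D` expected queries of bit `i` (`mul_output_le`, resting
on `exists_run_eq`, `likelihood_update` and `exists_expect_count`). Summing over `i` gives `n l / D`
up to lower order (`le_of_worstCaseError_le`).

Sufficiency. The bits are tested one after the other by random walks with asymmetric barriers,
stopping at the first acceptance of `z`. Rejection needs a net descent of `a + 1 ≈ l / L` steps, so
a true `z` is missed with probability at most `δ`. Acceptance needs a net ascent of `b ≈ (l + log n)
/ L` steps, so that a union bound over `n` bits controls false acceptance. A walk has drift `1 - 2p`
in the correct direction, so a rejection costs about `l / D` queries. The larger barrier is paid for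
essentially once, which is of lower order than `n l / D`. Error and cost are both bounded by
supermartingales (`expect_run_sequentialTests_le`). -/

theorem klBern_eq (p : unitInterval) (hp0 : 0 < (p : ℝ)) (hp1 : (p : ℝ) < 1 / 2) :
    klBern p = (1 - 2 * (p : ℝ)) * Real.log ((1 - p) / p) := by
  have hq0 : 0 < 1 - (p : ℝ) := by linarith
  set μ := ProbabilityTheory.bernoulliMeasure true false p with hμ
  set ν := ProbabilityTheory.bernoulliMeasure true false (unitInterval.symm p) with hν
  have hμt : μ {true} = ENNReal.ofReal p := by
    simp [hμ, ProbabilityTheory.bernoulliMeasure_def, ENNReal.ofReal]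
    ext; simp [hp0.le]
  have hμf : μ {false} = ENNReal.ofReal (1 - p) := by
    simp [hμ, ProbabilityTheory.bernoulliMeasure_def, ENNReal.ofReal]
    ext; simp [hq0.le]
  have hνt : ν {true} = ENNReal.ofReal (1 - p) := by
    simp [hν, ProbabilityTheory.bernoulliMeasure_def, ENNReal.ofReal]
    ext; simp [hq0.le]
  have hνf : ν {false} = ENNReal.ofReal p := by
    simp [hν, ProbabilityTheory.bernoulliMeasure_def, ENNReal.ofReal]
    ext; simp [hp0.le]
  have hac : μ.AbsolutelyContinuous ν := by
    intro s hs
    have ht : true ∉ s := fun h => by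
      have := MeasureTheory.measure_mono_null (Set.singleton_subset_iff.2 h) hs
      rw [hνt, ENNReal.ofReal_eq_zero] at this; linarith
    have hf : false ∉ s := fun h => by
      have := MeasureTheory.measure_mono_null (Set.singleton_subset_iff.2 h) hs
      rw [hνf, ENNReal.ofReal_eq_zero] at this; linarith
    have : s = ∅ := by
      ext b; cases b <;> simp [ht, hf]
    simp [this]
  have hd (b : Bool) : μ.rnDeriv ν b * ν {b} = μ {b} := by
    rw [← MeasureTheory.lintegral_singleton, MeasureTheory.Measure.setLIntegral_rnDeriv hac]
  have hdt : (μ.rnDeriv ν true).toReal = p / (1 - p) := by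
    have := congrArg ENNReal.toReal (hd true)
    rw [hμt, hνt, ENNReal.toReal_mul, ENNReal.toReal_ofReal hp0.le,
      ENNReal.toReal_ofReal hq0.le] at this
    field_simp; exact this
  have hdf : (μ.rnDeriv ν false).toReal = (1 - p) / p := by
    have := congrArg ENNReal.toReal (hd false)
    rw [hμf, hνf, ENNReal.toReal_mul, ENNReal.toReal_ofReal hp0.le,
      ENNReal.toReal_ofReal hq0.le] at this
    field_simp; exact this
  rw [klBern, InformationTheory.toReal_klDiv_of_measure_eq hac (by simp [hμ, hν]), hμ,
    ProbabilityTheory.integral_bernoulliMeasure, ← hμ]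
  simp only [MeasureTheory.llr_def, hdt, hdf, smul_eq_mul]
  rw [← inv_div, Real.log_inv]
  simp
  ring

/-- The function which computes the bit `z` if some input bit is `z`. -/
def existsBit (z : Bool) {n : ℕ} (x : Fin n → Bool) : Bool := if ∃ i, x i = z then z else !z

theorem orFn_eq {n : ℕ} : (orFn : (Fin n → Bool) → Bool) = existsBit true := by
  funext x; by_cases h : ∃ i, x i = true <;> simp [orFn, existsBit, h]

theorem andFn_eq {n : ℕ} : (andFn : (Fin n → Bool) → Bool) = existsBit false := by
  funext x
  by_cases h : ∃ i, x i = false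
  · have h' : ¬ ∀ i, x i = true := by simpa using h
    simp [andFn, existsBit, h, h']
  · have h' : ∀ i, x i = true := by simpa using h
    simp [andFn, existsBit, h']

/-! ### Expectations under discrete distributions. -/

/-- Expectation of a nonnegative function under a discrete distribution. -/
noncomputable def expect {α : Type*} (μ : PMF α) (F : α → ℝ≥0∞) : ℝ≥0∞ := ∑' a, μ a * F a

section expect
variable {α β : Type*}

theorem expect_pure (a : α) (F : α → ℝ≥0∞) : expect (PMF.pure a) F = F a := by
  rw [expect, tsum_eq_single a]
  · simp
  · intro b hb; simp [PMF.pure_apply, hb]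

theorem expect_bind (μ : PMF α) (κ : α → PMF β) (F : β → ℝ≥0∞) :
    expect (μ.bind κ) F = expect μ fun a => expect (κ a) F := by
  simp only [expect, PMF.bind_apply, ← ENNReal.tsum_mul_right, ← ENNReal.tsum_mul_left]
  rw [ENNReal.tsum_comm]
  simp only [mul_assoc]

theorem expect_map (μ : PMF α) (g : α → β) (F : β → ℝ≥0∞) :
    expect (μ.map g) F = expect μ fun a => F (g a) := by
  rw [PMF.map, expect_bind]; simp [expect_pure]

theorem expect_mono (μ : PMF α) {F G : α → ℝ≥0∞} (h : ∀ a, F a ≤ G a) :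
    expect μ F ≤ expect μ G :=
  ENNReal.tsum_le_tsum fun a => mul_le_mul_right (h a) _

theorem expect_add (μ : PMF α) (F G : α → ℝ≥0∞) :
    expect μ (fun a => F a + G a) = expect μ F + expect μ G := by
  simp only [expect, mul_add, ENNReal.tsum_add]

theorem expect_const_mul (μ : PMF α) (c : ℝ≥0∞) (F : α → ℝ≥0∞) :
    expect μ (fun a => c * F a) = c * expect μ F := by
  simp only [expect, ← ENNReal.tsum_mul_left, mul_left_comm]

theorem expect_const (μ : PMF α) (c : ℝ≥0∞) : expect μ (fun _ => c) = c := by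
  simp [expect, ENNReal.tsum_mul_right]

theorem expect_indicator (μ : PMF α) (s : Set α) [DecidablePred (· ∈ s)] :
    expect μ (fun a => if a ∈ s then 1 else 0) = μ.toOuterMeasure s := by
  simp [expect, PMF.toOuterMeasure_apply, Set.indicator_apply]

end expect

theorem noisyRead_self (p : unitInterval) (b : Bool) : noisyRead p b b = ENNReal.ofReal (1 - p) := by
  simp [noisyRead]

theorem noisyRead_ne (p : unitInterval) {b y : Bool} (h : y ≠ b) :
    noisyRead p b y = ENNReal.ofReal p := by
  simp [noisyRead, h]

theorem expect_noisyRead (p : unitInterval) (b : Bool) (F : Bool → ℝ≥0∞) :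
    expect (noisyRead p b) F = ENNReal.ofReal (1 - p) * F b + ENNReal.ofReal p * F (!b) := by
  rw [expect, tsum_bool]
  cases b <;> simp [noisyRead, add_comm]

/-! ### Supermartingales and output probabilities along a run. -/

section run
variable {n : ℕ} (p : unitInterval) (A : Algorithm n) (x : Fin n → Bool)

theorem expectedQueries_eq :
    expectedQueries p A x = ⨆ t, expect (run p A x t) fun c => (c.1.length : ℝ≥0∞) := rfl

theorem expect_run_succ (t : ℕ) (F : Config n → ℝ≥0∞) :
    expect (run p A x (t + 1)) F = expect (run p A x t) fun c => expect (step p A x c) F :=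
  expect_bind _ _ _

theorem expect_step_some (h : Transcript n) (b : Bool) (F : Config n → ℝ≥0∞) :
    expect (step p A x (h, some b)) F = F (h, some b) := expect_pure _ _

/-- The expected value of `F` after taking the action `a` with transcript `h`. -/
noncomputable def actionValue (h : Transcript n) (F : Config n → ℝ≥0∞) : Action n → ℝ≥0∞
  | .query i => expect (noisyRead p (x i)) fun y => F ((i, y) :: h, none)
  | .output b => F (h, some b)

theorem expect_step_none (h : Transcript n) (F : Config n → ℝ≥0∞) :
    expect (step p A x (h, none)) F = expect (A h) (actionValue p x h F) := by
  rw [step, expect_bind]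
  congr 1; funext a
  cases a with
  | query i => exact expect_map _ _ _
  | output b => exact expect_pure _ _

/-- A function that does not increase in expectation along any step is bounded in expectation by
its initial value. -/
theorem expect_run_le {G : Config n → ℝ≥0∞} (hG : ∀ c, expect (step p A x c) G ≤ G c) (t : ℕ) :
    expect (run p A x t) G ≤ G ([], none) := by
  induction t with
  | zero => exact (expect_pure _ _).le
  | succ t ih => exact (expect_run_succ p A x t G).trans_le ((expect_mono _ hG).trans ih)

/-- An output is never revoked. -/
theorem expect_output_mono (b : Bool) :
    Monotone fun t => expect (run p A x t) fun c => if c.2 = some b then 1 else 0 := by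
  refine monotone_nat_of_le_succ fun t => ?_
  rw [expect_run_succ]
  refine expect_mono _ fun c => ?_
  obtain ⟨h, _ | b'⟩ := c
  · simp
  · rw [expect_step_some]

theorem expect_output_add (t : ℕ) (b : Bool) :
    expect (run p A x t) (fun c => if c.2 = some b then 1 else 0) +
      (run p A x t).toOuterMeasure {c | c.2 ≠ some b} = 1 := by
  classical
  rw [← expect_indicator, ← expect_add]
  refine Eq.trans ?_ (expect_const (run p A x t) 1)
  congr 1; funext c
  by_cases h : c.2 = some b <;> simp [h]

theorem worstCaseError_le_iff {f : (Fin n → Bool) → Bool} {e : ℝ≥0∞} :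
    worstCaseError p A f ≤ e ↔ ∀ x, errorProb p A f x ≤ e := iSup_le_iff

/-- The probability of a wrong output at any time is at most the error probability. -/
theorem expect_output_not_le_errorProb (f : (Fin n → Bool) → Bool) (t : ℕ) :
    expect (run p A x t) (fun c => if c.2 = some (!f x) then 1 else 0) ≤ errorProb p A f x := by
  classical
  -- The error event is bounded at an arbitrary time `s` and the wrong output at time `t`; both are
  -- compared at the common time `max t s`, by which no output has been revoked.
  refine le_iInf fun s => ?_
  have h1 := expect_output_mono p A x (!f x) (le_max_left t s)
  have h2 := expect_output_mono p A x (f x) (le_max_right t s)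
  have h3 := expect_output_add p A x (max t s) (f x)
  have h4 := expect_output_add p A x s (f x)
  set E := expect (run p A x (max t s)) fun c => if c.2 = some (f x) then 1 else 0
  have hE : E ≠ ∞ := ne_top_of_le_ne_top ENNReal.one_ne_top (h3 ▸ le_self_add)
  have h5 : (run p A x (max t s)).toOuterMeasure {c | c.2 ≠ some (f x)} ≤
      (run p A x s).toOuterMeasure {c | c.2 ≠ some (f x)} := by
    refine (ENNReal.add_le_add_iff_left hE).1 ?_
    rw [h3, ← h4]
    gcongr
  refine h1.trans (le_trans ?_ h5)
  rw [← expect_indicator]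
  refine expect_mono _ fun c => ?_
  by_cases h : c.2 = some (!f x) <;> simp [h]

end run

/-! ### Likelihoods, change of measure and query counts. -/

section likelihood
variable {n : ℕ} (p : unitInterval) (A : Algorithm n) (x : Fin n → Bool)

/-- The probability of the responses in a transcript, given its queries. -/
noncomputable def likelihood (h : Transcript n) : ℝ≥0∞ :=
  (h.map fun c => noisyRead p (x c.1) c.2).prod

theorem likelihood_cons (i : Fin n) (y : Bool) (h : Transcript n) :
    likelihood p x ((i, y) :: h) = noisyRead p (x i) y * likelihood p x h := by
  simp [likelihood]

/-- The transition probabilities depend on the input only through the likelihood of the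
responses. -/
theorem exists_step_eq (c' c : Config n) :
    ∃ K : ℝ≥0∞, ∀ x, likelihood p x c'.1 * step p A x c' c = K * likelihood p x c.1 := by
  obtain ⟨h, _ | b⟩ := c'
  · let k : Action n → ℝ≥0∞
      | .query i => ∑ y, if c = ((i, y) :: h, none) then 1 else 0
      | .output b => if c = (h, some b) then 1 else 0
    refine ⟨∑' a, A h a * k a, fun x => ?_⟩
    rw [step, PMF.bind_apply, ← ENNReal.tsum_mul_left, ← ENNReal.tsum_mul_right]
    refine tsum_congr fun a => ?_
    rw [mul_left_comm, mul_assoc]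
    congr 1
    cases a with
    | query i =>
      simp only [k, PMF.map_apply, tsum_bool, Fintype.sum_bool]
      by_cases h1 : c = ((i, true) :: h, none)
      · subst h1; simp [likelihood_cons, mul_comm]
      · by_cases h2 : c = ((i, false) :: h, none)
        · subst h2; simp [likelihood_cons, mul_comm]
        · simp [h1, h2]
    | output b =>
      by_cases h1 : c = (h, some b)
      · subst h1; simp [k]
      · simp [k, h1]
  · refine ⟨if c = (h, some b) then 1 else 0, fun x => ?_⟩
    by_cases h1 : c = (h, some b)
    · subst h1; simp [step]
    · simp [step, h1]

/-- The algorithm's own choices are collected in `R`, which is the same for all inputs. Hence the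
ratio of the laws of a run on two inputs is the ratio of their likelihoods. -/
theorem exists_run_eq (t : ℕ) :
    ∃ R : Config n → ℝ≥0∞, ∀ x c, run p A x t c = R c * likelihood p x c.1 := by
  induction t with
  | zero =>
    refine ⟨fun c => if c = ([], none) then 1 else 0, fun x c => ?_⟩
    by_cases h1 : c = ([], none)
    · subst h1; simp [run, likelihood]
    · simp [run, h1]
  | succ t ih =>
    obtain ⟨R, hR⟩ := ih
    choose K hK using exists_step_eq p A
    refine ⟨fun c => ∑' c', R c' * K c' c, fun x c => ?_⟩
    rw [run, PMF.bind_apply, ← ENNReal.tsum_mul_right]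
    refine tsum_congr fun c' => ?_
    rw [hR, mul_assoc, hK, mul_assoc]

theorem noisyRead_eq_mul_exp (hp0 : 0 < (p : ℝ)) (hp1 : (p : ℝ) < 1) (z : Bool) :
    noisyRead p z z =
      noisyRead p (!z) z * ENNReal.ofReal (Real.exp (Real.log ((1 - p) / p))) ∧
    noisyRead p z (!z) =
      noisyRead p (!z) (!z) * ENNReal.ofReal (Real.exp (-Real.log ((1 - p) / p))) := by
  have hq : 0 < 1 - (p : ℝ) := by linarith
  rw [noisyRead_self, noisyRead_self, noisyRead_ne p (by simp), noisyRead_ne p (by simp),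
    Real.exp_neg, Real.exp_log (by positivity), ← ENNReal.ofReal_mul hp0.le,
    ← ENNReal.ofReal_mul hq.le]
  constructor
  · congr 1; field_simp
  · congr 1; field_simp

/-- The likelihood ratio between two inputs that differ in the bit `i` only. -/
theorem likelihood_update (hp0 : 0 < (p : ℝ)) (hp1 : (p : ℝ) < 1) (z : Bool) (i : Fin n)
    (hx : x i = !z) (h : Transcript n) :
    likelihood p (Function.update x i z) h = likelihood p x h *
      ENNReal.ofReal (Real.exp
        (Real.log ((1 - p) / p) * ((h.count (i, z) : ℝ) - h.count (i, !z)))) := by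
  obtain ⟨h1, h2⟩ := noisyRead_eq_mul_exp p hp0 hp1 z
  set l := Real.log ((1 - p) / p)
  induction h with
  | nil => simp [likelihood]
  | cons c h ih =>
    obtain ⟨j, y⟩ := c
    rw [likelihood_cons, likelihood_cons, ih]
    by_cases hj : j = i
    · subst hj
      rw [Function.update_self, hx]
      by_cases hy : y = z
      · subst hy
        have e : (l * ((((j, y) :: h).count (j, y) : ℝ) - ((j, y) :: h).count (j, !y))) =
            l + l * ((h.count (j, y) : ℝ) - h.count (j, !y)) := by
          simp; ring
        rw [e, Real.exp_add, ENNReal.ofReal_mul (Real.exp_pos _).le, h1]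
        ring
      · obtain rfl : y = !z := by cases y <;> cases z <;> first | rfl | exact absurd rfl hy
        have e : (l * ((((j, !z) :: h).count (j, z) : ℝ) - ((j, !z) :: h).count (j, !z))) =
            -l + l * ((h.count (j, z) : ℝ) - h.count (j, !z)) := by
          simp; ring
        rw [e, Real.exp_add, ENNReal.ofReal_mul (Real.exp_pos _).le, h2]
        ring
    · rw [Function.update_of_ne hj]
      have e (y') : ((j, y) :: h).count (i, y') = h.count (i, y') := by
        simp [hj]
      rw [e, e, mul_assoc]

theorem expect_noisyRead_ite (b y : Bool) (a : ℝ≥0∞) :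
    (expect (noisyRead p b) fun y' => a + if y' = y then 1 else 0) = a + noisyRead p b y := by
  rw [expect_add, expect_const]
  congr 1
  rw [expect, tsum_eq_single y]
  · simp
  · intro y' h; simp [h]

/-- Each response is wrong with probability `p`, so the expected numbers of responses of either
kind to queries of bit `i` are proportional. -/
theorem exists_expect_count (i : Fin n) (t : ℕ) :
    ∃ S : ℝ≥0∞, ∀ y, (expect (run p A x t) fun c => (c.1.count (i, y) : ℝ≥0∞)) =
      noisyRead p (x i) y * S := by
  classical
  induction t with
  | zero => exact ⟨0, fun y => by rw [run, expect_pure]; simp⟩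
  | succ t ih =>
    obtain ⟨S, hS⟩ := ih
    -- Conditional probability that the next action is a query of bit `i`. The factor `S`
    -- accumulates these, so it is the expected number of such queries, as in Wald's identity.
    let g : Config n → ℝ≥0∞ := fun c => if c.2 = none then A c.1 (.query i) else 0
    refine ⟨S + expect (run p A x t) g, fun y => ?_⟩
    rw [expect_run_succ, mul_add, ← hS, ← expect_const_mul, ← expect_add]
    congr 1; funext c
    obtain ⟨h, _ | b⟩ := c
    · rw [expect_step_none]
      have hv (a : Action n) : actionValue p x h (fun c => (c.1.count (i, y) : ℝ≥0∞)) a =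
          h.count (i, y) + noisyRead p (x i) y * (if a = .query i then 1 else 0) := by
        cases a with
        | output b => simp [actionValue]
        | query j =>
          by_cases hj : j = i
          · subst hj
            simp only [actionValue, ite_true, mul_one, ← expect_noisyRead_ite]
            congr 1; funext y'
            by_cases hy : y' = y <;> simp [hy]
          · simp [actionValue, hj, expect_const]
      rw [show actionValue p x h (fun c => (c.1.count (i, y) : ℝ≥0∞)) = _ from funext hv,
        expect_add, expect_const, expect_const_mul]
      simp only [g, ite_true]
      congr 2
      rw [expect, tsum_eq_single (.query i)]
      · simp
      · intro a ha; simp [ha]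
    · rw [expect_step_some]; simp [g]

theorem sum_count_eq_length (h : Transcript n) :
    ∑ i, (h.count (i, true) + h.count (i, false)) = h.length := by
  induction h with
  | nil => simp
  | cons c h ih =>
    obtain ⟨j, y⟩ := c
    rw [List.length_cons, ← ih, ← Finset.sum_erase_add _ _ (Finset.mem_univ j),
      ← Finset.sum_erase_add (a := j) _ (fun i => h.count (i, true) + h.count (i, false))
        (Finset.mem_univ j)]
    have : ∑ i ∈ Finset.univ.erase j,
        (((j, y) :: h).count (i, true) + ((j, y) :: h).count (i, false)) =
        ∑ i ∈ Finset.univ.erase j, (h.count (i, true) + h.count (i, false)) := by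
      refine Finset.sum_congr rfl fun i hi => ?_
      have : j ≠ i := (Finset.ne_of_mem_erase hi).symm
      simp [this]
    rw [this]
    cases y <;> simp <;> ring

end likelihood

/-! ### The lower bound on the number of queries. -/

section lower
variable {n : ℕ} (p : unitInterval) (A : Algorithm n)

/-- If the output `w` has probability `P` on an input `x` and at most `exp (-l)` when bit `i` is
flipped, then the expected number `N` of queries of bit `i` on `x` is bounded below. -/
theorem mul_output_le (hp0 : 0 < (p : ℝ)) (hp1 : (p : ℝ) < 1 / 2) (x : Fin n → Bool) (z w : Bool)
    (i : Fin n) (hx : x i = !z) (t : ℕ) {l : ℝ} (hl : 0 ≤ l)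
    (hQ : expect (run p A (Function.update x i z) t) (fun c => if c.2 = some w then 1 else 0) ≤
      ENNReal.ofReal (Real.exp (-l)))
    (hN : expect (run p A x t) (fun c => (c.1.count (i, true) + c.1.count (i, false) : ℝ≥0∞)) ≠ ∞) :
    l * (expect (run p A x t) (fun c => if c.2 = some w then 1 else 0)).toReal ≤
      klBern p * (expect (run p A x t)
        (fun c => (c.1.count (i, true) + c.1.count (i, false) : ℝ≥0∞))).toReal + Real.log 2 := by
  have hq : 0 < 1 - (p : ℝ) := by linarith
  have hL : 0 ≤ Real.log ((1 - p) / p) := by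
    refine Real.log_nonneg ?_
    rw [le_div_iff₀ hp0]; linarith
  have hlog2 := Real.log_nonneg one_le_two
  obtain ⟨S, hS⟩ := exists_expect_count p A x i t
  have hNS : expect (run p A x t)
      (fun c => (c.1.count (i, true) + c.1.count (i, false) : ℝ≥0∞)) = S := by
    rw [expect_add, hS, hS, ← add_mul]
    have : noisyRead p (x i) true + noisyRead p (x i) false = 1 := by
      rw [add_comm, ← tsum_bool (noisyRead p (x i)), PMF.tsum_coe]
    rw [this, one_mul]
  rw [hNS] at hN ⊢
  obtain ⟨R, hR⟩ := exists_run_eq p A t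
  rw [klBern_eq p hp0 hp1]
  set L := Real.log ((1 - p) / p) with hLdef
  set I : Config n → ℝ≥0∞ := fun c => if c.2 = some w then 1 else 0 with hI
  -- Gibbs' variational inequality, pointwise. With `u` and `v` the numbers of responses `z` and
  -- `!z` for bit `i`, and `j` the indicator of output `w`, apply `1 + y ≤ exp y` to `y = L (u - v)
  -- + l j - log 2`. The factor `exp (L (u - v))` turns the law on `x` into the law on the flipped
  -- input, and `exp (l j) ≤ 1 + exp l * j` since `j` is 0 or 1. On the flipped input the mean of `1
  -- + exp l * j` is at most 2, which the shift by `log 2` compensates. Negative terms are moved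
  -- across to stay in `ℝ≥0∞`.
  have key : expect (run p A x t) (fun c => 1 + ENNReal.ofReal l * I c +
        ENNReal.ofReal L * (c.1.count (i, z) : ℝ≥0∞)) ≤
      expect (run p A (Function.update x i z) t)
        (fun c => ENNReal.ofReal (1 / 2) * (1 + ENNReal.ofReal (Real.exp l) * I c)) +
      expect (run p A x t) (fun c => ENNReal.ofReal L * (c.1.count (i, !z) : ℝ≥0∞) +
        ENNReal.ofReal (Real.log 2)) := by
    rw [expect, expect, expect, ← ENNReal.tsum_add]
    refine ENNReal.tsum_le_tsum fun c => ?_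
    rw [hR x, hR (Function.update x i z), likelihood_update p x hp0 (by linarith) z i hx c.1,
      ← mul_assoc (R c), mul_assoc (R c * likelihood p x c.1) _ (_ * _), ← mul_add,
      ← hLdef]
    refine mul_le_mul_right ?_ _
    set u : ℝ := (c.1.count (i, z) : ℝ)
    set v : ℝ := (c.1.count (i, !z) : ℝ)
    have hu : (c.1.count (i, z) : ℝ≥0∞) = ENNReal.ofReal u := by simp [u]
    have hv : (c.1.count (i, !z) : ℝ≥0∞) = ENNReal.ofReal v := by simp [v]
    have hu0 : 0 ≤ u := Nat.cast_nonneg _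
    have hv0 : 0 ≤ v := Nat.cast_nonneg _
    have hJ : I c = ENNReal.ofReal (if c.2 = some w then 1 else 0) := by
      by_cases h : c.2 = some w <;> simp [hI, h]
    set j : ℝ := if c.2 = some w then 1 else 0 with hj
    have hj0 : 0 ≤ j := by rw [hj]; split_ifs <;> norm_num
    have he : Real.exp (l * j) ≤ 1 + Real.exp l * j := by
      rw [hj]; split_ifs <;> simp
    rw [hu, hv, hJ, ← ENNReal.ofReal_one, ← ENNReal.ofReal_mul hl, ← ENNReal.ofReal_mul hL,
      ← ENNReal.ofReal_mul hL, ← ENNReal.ofReal_mul (Real.exp_pos _).le,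
      ← ENNReal.ofReal_add zero_le_one (by positivity),
      ← ENNReal.ofReal_add (by positivity) (by positivity),
      ← ENNReal.ofReal_add zero_le_one (by positivity),
      ← ENNReal.ofReal_mul (by norm_num), ← ENNReal.ofReal_mul (Real.exp_pos _).le,
      ← ENNReal.ofReal_add (by positivity) (by positivity),
      ← ENNReal.ofReal_add (by positivity) (by positivity)]
    refine ENNReal.ofReal_le_ofReal ?_
    have h1 := Real.add_one_le_exp (L * (u - v) + l * j - Real.log 2)
    rw [Real.exp_sub, Real.exp_log two_pos, Real.exp_add] at h1
    have h2 : Real.exp (L * (u - v)) * Real.exp (l * j) / 2 ≤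
        Real.exp (L * (u - v)) * (1 / 2 * (1 + Real.exp l * j)) := by
      have := mul_le_mul_of_nonneg_left he (Real.exp_pos (L * (u - v))).le
      linarith
    linarith
  have hexp : ENNReal.ofReal (Real.exp l) * ENNReal.ofReal (Real.exp (-l)) = 1 := by
    rw [← ENNReal.ofReal_mul (Real.exp_pos _).le, ← Real.exp_add]; simp
  have key2 : 1 + ENNReal.ofReal l * expect (run p A x t) I +
      ENNReal.ofReal L * (ENNReal.ofReal p * S) ≤
      1 + (ENNReal.ofReal L * (ENNReal.ofReal (1 - p) * S) + ENNReal.ofReal (Real.log 2)) := by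
    have hz : noisyRead p (x i) z = ENNReal.ofReal p := noisyRead_ne p (by rw [hx]; simp)
    have hz' : noisyRead p (x i) (!z) = ENNReal.ofReal (1 - p) := by
      rw [hx, noisyRead_self]
    rw [← hz, ← hz', ← hS, ← hS]
    simp only [expect_add, expect_const, expect_const_mul] at key
    refine key.trans ?_
    gcongr
    calc ENNReal.ofReal (1 / 2) * (1 + ENNReal.ofReal (Real.exp l) *
          expect (run p A (Function.update x i z) t) I)
        ≤ ENNReal.ofReal (1 / 2) * (1 + 1) := by
          gcongr
          rw [← hexp]
          gcongr
      _ = 1 := by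
          rw [← ENNReal.ofReal_one, ← ENNReal.ofReal_add zero_le_one zero_le_one,
            ← ENNReal.ofReal_mul (by norm_num)]
          norm_num
  have hP : expect (run p A x t) I ≠ ∞ := by
    refine ne_top_of_le_ne_top ENNReal.one_ne_top ?_
    rw [← expect_const (run p A x t) 1]
    exact expect_mono _ fun c => by simp only [hI]; split_ifs <;> simp
  set P := expect (run p A x t) I
  have hP' : P = ENNReal.ofReal P.toReal := (ENNReal.ofReal_toReal hP).symm
  have hS' : S = ENNReal.ofReal S.toReal := (ENNReal.ofReal_toReal hN).symm
  have hP0 := ENNReal.toReal_nonneg (a := P)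
  have hS0 := ENNReal.toReal_nonneg (a := S)
  rw [hP', hS', ← ENNReal.ofReal_one, ← ENNReal.ofReal_mul hl, ← ENNReal.ofReal_mul hp0.le,
    ← ENNReal.ofReal_mul hL, ← ENNReal.ofReal_mul hq.le, ← ENNReal.ofReal_mul hL,
    ← ENNReal.ofReal_add zero_le_one (by positivity),
    ← ENNReal.ofReal_add (by positivity) (by positivity),
    ← ENNReal.ofReal_add (by positivity) (by positivity),
    ← ENNReal.ofReal_add zero_le_one (by positivity),
    ENNReal.ofReal_le_ofReal_iff (by positivity)] at key2
  linarith

/-- A nonasymptotic lower bound on the number of queries. -/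
theorem le_of_worstCaseError_le (hp0 : 0 < (p : ℝ)) (hp1 : (p : ℝ) < 1 / 2) (z : Bool)
    {d B : ℝ} (hd0 : 0 < d) (hd1 : d ≤ 1) (hB : 0 ≤ B)
    (hE : worstCaseError p A (existsBit z) ≤ ENNReal.ofReal d)
    (hM : ∀ x, expectedQueries p A x ≤ ENNReal.ofReal B) :
    n * (Real.log (1 / d) * (1 - 2 * d) - Real.log 2) ≤ klBern p * B := by
  classical
  rw [worstCaseError_le_iff] at hE
  set x : Fin n → Bool := fun _ => !z with hx
  have hfx : existsBit z x = !z := by simp [existsBit, hx]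
  have hl : 0 ≤ Real.log (1 / d) := Real.log_nonneg (by rw [le_div_iff₀ hd0]; linarith)
  have hel : Real.exp (-Real.log (1 / d)) = d := by
    rw [one_div, Real.log_inv, neg_neg, Real.exp_log hd0]
  -- The error probability is an infimum over times that need not be attained; allowing `2 * d`
  -- gives a finite time `t`. On the flipped inputs the bound `d` on wrong outputs holds at every
  -- time, so the same `t` serves all `i`.
  obtain ⟨t, ht⟩ : ∃ t, (run p A x t).toOuterMeasure {c | c.2 ≠ some (existsBit z x)} <
      ENNReal.ofReal (2 * d) := by
    rw [← iInf_lt_iff]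
    exact (hE x).trans_lt ((ENNReal.ofReal_lt_ofReal_iff (by linarith)).2 (by linarith))
  rw [hfx] at ht
  have hadd := expect_output_add p A x t (!z)
  set P := expect (run p A x t) fun c => if c.2 = some (!z) then 1 else 0
  have hP : 1 - 2 * d ≤ P.toReal := by
    have h2 : P ≠ ∞ := ne_top_of_le_ne_top ENNReal.one_ne_top (hadd ▸ le_self_add)
    have h3 := congrArg ENNReal.toReal hadd
    rw [ENNReal.toReal_add h2 ht.ne_top, ENNReal.toReal_one] at h3
    have h4 := ENNReal.toReal_mono ENNReal.ofReal_ne_top ht.le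
    rw [ENNReal.toReal_ofReal (by linarith)] at h4
    linarith
  set N : Fin n → ℝ≥0∞ := fun i => expect (run p A x t)
    (fun c => (c.1.count (i, true) + c.1.count (i, false) : ℝ≥0∞)) with hN
  have hsum : ∑ i, N i = expect (run p A x t) fun c => (c.1.length : ℝ≥0∞) := by
    simp only [hN, expect]
    rw [← Summable.tsum_finsetSum (fun _ _ => ENNReal.summable)]
    refine tsum_congr fun c => ?_
    rw [← Finset.mul_sum, ← sum_count_eq_length c.1]
    push_cast
    rfl
  have hsumB : ∑ i, N i ≤ ENNReal.ofReal B := by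
    rw [hsum]
    exact (le_iSup (fun t => expect (run p A x t) fun c => (c.1.length : ℝ≥0∞)) t).trans (hM x)
  have hNi (i) : N i ≠ ∞ := ne_top_of_le_ne_top ENNReal.ofReal_ne_top
    ((Finset.single_le_sum (fun _ _ => zero_le) (Finset.mem_univ i)).trans hsumB)
  have hD : 0 ≤ klBern p := ENNReal.toReal_nonneg
  have hi (i : Fin n) : Real.log (1 / d) * (1 - 2 * d) - Real.log 2 ≤
      klBern p * (N i).toReal := by
    have hfu : existsBit z (Function.update x i z) = z := by
      have : ∃ j, Function.update x i z j = z := ⟨i, by simp⟩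
      simp only [existsBit, if_pos this]
    have hQ := (expect_output_not_le_errorProb p A (Function.update x i z) (existsBit z) t).trans
      (hE _)
    rw [hfu] at hQ
    rw [← hel] at hQ
    have := mul_output_le p A hp0 hp1 x z (!z) i rfl t hl (by simpa using hQ) (hNi i)
    have h2 := mul_le_mul_of_nonneg_left hP hl
    linarith
  calc n * (Real.log (1 / d) * (1 - 2 * d) - Real.log 2)
      = ∑ i : Fin n, (Real.log (1 / d) * (1 - 2 * d) - Real.log 2) := by
        rw [Finset.sum_const, Finset.card_univ, Fintype.card_fin, nsmul_eq_mul]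
    _ ≤ ∑ i, klBern p * (N i).toReal := Finset.sum_le_sum fun i _ => hi i
    _ = klBern p * (∑ i, N i).toReal := by
        rw [← Finset.mul_sum, ENNReal.toReal_sum fun i _ => hNi i]
    _ ≤ klBern p * B := by
        gcongr
        have := ENNReal.toReal_mono ENNReal.ofReal_ne_top hsumB
        rwa [ENNReal.toReal_ofReal hB] at this

end lower
-- Sequential tests: error probabilities and expected cost.
section upper

/-- The state `(i, s)` means that bit `i` is being tested and that the test walk is `s + 1` steps
above its lower barrier. On reaching the lower barrier the test of the next bit starts. -/
def nextState (a : ℕ) (up : Bool) : ℕ × ℕ → ℕ × ℕ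
  | (i, s) => if up then (i, s + 1) else match s with
    | 0 => (i + 1, a)
    | s + 1 => (i, s)

theorem nextState_true (a i s : ℕ) : nextState a true (i, s) = (i, s + 1) := rfl

theorem nextState_false_zero (a i : ℕ) : nextState a false (i, 0) = (i + 1, a) := rfl

theorem nextState_false_succ (a i s : ℕ) : nextState a false (i, s + 1) = (i, s) := rfl

/-- The state of the sequential tests after a transcript. -/
def stateOf {n : ℕ} (z : Bool) (a : ℕ) : Transcript n → ℕ × ℕ
  | [] => (0, a)
  | (_, y) :: h => nextState a (y == z) (stateOf z a h)

/-- Test the bits one after the other by sequential probability ratio tests of the value `z`.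
Output `z` as soon as a test reaches its upper barrier, and `!z` if all reach the lower one. -/
noncomputable def sequentialTests (n : ℕ) (z : Bool) (a b : ℕ) : Algorithm n := fun h =>
  if hi : (stateOf z a h).1 < n then
    if a + b ≤ (stateOf z a h).2 then PMF.pure (.output z)
    else PMF.pure (.query ⟨(stateOf z a h).1, hi⟩)
  else PMF.pure (.output !z)

variable {n : ℕ} (p : unitInterval) (x : Fin n → Bool) (z : Bool) (a b : ℕ)

/-- A potential on the states which decreases by `k` per query bounds `k` times the number of
queries plus a terminal value. -/
theorem expect_run_sequentialTests_le (χ : ℕ → Bool) (hχ : ∀ i : Fin n, χ i = (x i == z))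
    (k : ℝ) (hk : 0 ≤ k) (φ : ℕ × ℕ → ℝ) (τ : Bool → ℝ)
    (hφ : ∀ i s, s ≤ a + b → 0 ≤ φ (i, s))
    (hz : ∀ i s, i < n → a + b ≤ s →
      -- The comparison is truncated at 0 because the potential for the query count may be negative
      -- above the upper barrier.
      ENNReal.ofReal (τ z) ≤ ENNReal.ofReal (φ (i, s)))
    (hend : ∀ i s, n ≤ i → τ (!z) ≤ φ (i, s))
    (hdrift : ∀ i s, i < n → s < a + b →
      k + (1 - p) * φ (nextState a (χ i) (i, s)) + p * φ (nextState a (!χ i) (i, s)) ≤ φ (i, s))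
    (t : ℕ) :
    (expect (run p (sequentialTests n z a b) x t) fun c =>
      ENNReal.ofReal k * c.1.length + c.2.elim 0 fun y => ENNReal.ofReal (τ y)) ≤
      ENNReal.ofReal (φ (0, a)) := by
  -- A supermartingale: the cost paid so far, plus the potential while running or the terminal value
  -- after stopping.
  let G : Config n → ℝ≥0∞ := fun c => ENNReal.ofReal k * c.1.length +
    c.2.elim (ENNReal.ofReal (φ (stateOf z a c.1))) fun y => ENNReal.ofReal (τ y)
  have hG : ∀ c, expect (step p (sequentialTests n z a b) x c) G ≤ G c := by
    rintro ⟨h, _ | y⟩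
    · rw [expect_step_none, sequentialTests]
      rcases hst : stateOf z a h with ⟨i, s⟩
      dsimp only
      by_cases hi : i < n
      · rw [dif_pos hi]
        by_cases hs : a + b ≤ s
        · rw [if_pos hs, expect_pure]
          simp only [actionValue, G, Option.elim, hst]
          gcongr 1
          exact hz i s hi hs
        · rw [if_neg hs, expect_pure]
          have hx1 : (x ⟨i, hi⟩ == z) = χ i := (hχ ⟨i, hi⟩).symm
          have hx2 : ((!x ⟨i, hi⟩) == z) = !χ i := by
            rw [← hx1]; cases x ⟨i, hi⟩ <;> cases z <;> rfl
          simp only [actionValue, expect_noisyRead, G, Option.elim, stateOf, hst, hx1, hx2,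
            List.length_cons]
          have hs' := not_le.1 hs
          have hnn (up : Bool) : 0 ≤ φ (nextState a up (i, s)) := by
            cases up
            · cases s with
              | zero => exact hφ _ _ (Nat.le_add_right _ _)
              | succ s => exact hφ _ _ (by omega)
            · exact hφ _ _ (by omega)
          have hp := p.2.1
          have hq : 0 ≤ 1 - (p : ℝ) := by linarith [p.2.2]
          have hl : (0 : ℝ) ≤ h.length := Nat.cast_nonneg _
          have e (m : ℕ) : (m : ℝ≥0∞) = ENNReal.ofReal m := by simp
          have hd := hdrift i s hi hs'
          have h1 := hnn (χ i)
          have h2 := hnn (!χ i)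
          have h0 := hφ i s hs'.le
          rw [e, e, ← ENNReal.ofReal_mul hk, ← ENNReal.ofReal_mul hk,
            ← ENNReal.ofReal_add (by positivity) (hnn _),
            ← ENNReal.ofReal_add (by positivity) (hnn _),
            ← ENNReal.ofReal_mul hq, ← ENNReal.ofReal_mul hp,
            ← ENNReal.ofReal_add (by positivity) (by positivity),
            ← ENNReal.ofReal_add (by positivity) h0]
          refine ENNReal.ofReal_le_ofReal ?_
          push_cast
          linarith
      · rw [dif_neg hi, expect_pure]
        simp only [actionValue, G, Option.elim, hst]
        gcongr
        exact hend i s (not_lt.1 hi)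
    · rw [expect_step_some]
  refine (expect_mono _ fun c => ?_).trans ((expect_run_le p _ x hG t).trans ?_)
  · obtain ⟨h, _ | y⟩ := c <;> simp [G]
  · simp [G, stateOf]

theorem length_eq_of_run_ne_zero (A : Algorithm n) (t : ℕ) (c : Config n)
    (hc : run p A x t c ≠ 0) (hn : c.2 = none) : c.1.length = t := by
  induction t generalizing c with
  | zero =>
    rw [run, ← PMF.mem_support_iff, PMF.mem_support_pure_iff] at hc
    simp [hc]
  | succ t ih =>
    rw [run, ← PMF.mem_support_iff, PMF.mem_support_bind_iff] at hc
    obtain ⟨⟨h, _ | b⟩, hc', hs⟩ := hc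
    · rw [step, PMF.mem_support_bind_iff] at hs
      obtain ⟨_ | b, -, hs⟩ := hs
      · rw [PMF.mem_support_map_iff] at hs
        obtain ⟨y, -, rfl⟩ := hs
        simpa using ih _ hc' rfl
      · simp at hs; simp [hs] at hn
    · simp [step] at hs; simp [hs] at hn

/-- If the expected number of queries is finite, the error probability is the limit of the
probabilities of a wrong output. -/
theorem errorProb_le_of_expectedQueries (A : Algorithm n) (f : (Fin n → Bool) → Bool)
    {B e : ℝ≥0∞} (hB : B ≠ ∞) (hM : expectedQueries p A x ≤ B)
    (he : ∀ t, expect (run p A x t) (fun c => if c.2 = some (!f x) then 1 else 0) ≤ e) :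
    errorProb p A f x ≤ e := by
  classical
  -- Markov's inequality: a run that is still active after `t + 1` steps has made `t + 1` queries.
  have h1 (t : ℕ) : errorProb p A f x ≤ e + B / (t + 1 : ℕ) := by
    refine (iInf_le _ (t + 1)).trans ?_
    rw [← expect_indicator]
    have h2 : expect (run p A x (t + 1)) (fun c => if c.2 = none then 1 else 0) ≤
        B / (t + 1 : ℕ) := by
      rw [ENNReal.le_div_iff_mul_le (by simp) (by simp), mul_comm, ← expect_const_mul]
      refine le_trans ?_ ((le_iSup (fun t => expect (run p A x t)
        fun c => (c.1.length : ℝ≥0∞)) (t + 1)).trans hM)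
      refine ENNReal.tsum_le_tsum fun c => ?_
      by_cases h0 : run p A x (t + 1) c = 0
      · simp [h0]
      · by_cases hn : c.2 = none
        · dsimp only
          rw [length_eq_of_run_ne_zero p x A _ c h0 hn]; simp [hn]
        · simp [hn]
    refine le_trans ?_ (add_le_add (he (t + 1)) h2)
    rw [← expect_add]
    refine expect_mono _ fun c => ?_
    obtain ⟨h, _ | y⟩ := c
    · simp
    · cases y <;> cases f x <;> simp
  have h3 : Tendsto (fun t : ℕ => e + B / (t + 1 : ℕ)) atTop (𝓝 (e + 0)) := by
    refine tendsto_const_nhds.add ?_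
    have := ENNReal.Tendsto.const_div (a := B) (tendsto_add_atTop_iff_nat 1 |>.2
      ENNReal.tendsto_nat_nhds_top) (Or.inr hB)
    simpa using this
  rw [add_zero] at h3
  exact ge_of_tendsto' h3 h1

theorem exists_matches : ∃ χ : ℕ → Bool, ∀ i : Fin n, χ i = (x i == z) :=
  ⟨fun i => if h : i < n then x ⟨i, h⟩ == z else false, fun i => by simp⟩

theorem expectedQueries_sequentialTests_le (hp0 : 0 < (p : ℝ)) (hp1 : (p : ℝ) < 1 / 2)
    (hr : ((p : ℝ) / (1 - p)) ^ (a + 1) ≤ 1 / 2) :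
    expectedQueries p (sequentialTests n z a b) x ≤
      ENNReal.ofReal ((n * (a + 1) + 2 * b) / (1 - 2 * p)) := by
  obtain ⟨χ, hχ⟩ := exists_matches x z
  have hq : 0 < 1 - (p : ℝ) := by linarith
  have hq2 : 0 < 1 - 2 * (p : ℝ) := by linarith
  set r : ℝ := p / (1 - p) with hrdef
  have hr0 : 0 < r := by positivity
  have hrq : r * (1 - p) = p := by rw [hrdef]; field_simp
  set c : ℝ := 1 / (1 - 2 * p) with hc
  have hc0 : 0 < c := by positivity
  have hcp : c * (1 - 2 * p) = 1 := by rw [hc]; field_simp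
  -- Bound on the remaining cost when the test of bit `j` starts. A bit equal to `z` costs at most
  -- `c * b` plus, with probability at most 1/2, the cost `R (j + 1)` of going on; the term `2 * b`
  -- makes this at most `R (j + 1)`.
  set R : ℕ → ℝ := fun j => c * ((n - j) * (a + 1) + 2 * b) with hR
  have hR0 (j : ℕ) (hj : j ≤ n) : 0 ≤ R j := by
    have : (0 : ℝ) ≤ n - j := sub_nonneg.2 (by exact_mod_cast hj)
    positivity
  have hRs (j : ℕ) : R j = c * (a + 1) + R (j + 1) := by
    simp only [hR]; push_cast; ring
  -- The linear parts are distance to the barrier over the drift. For a bit equal to `z`, `r ^ (s +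
  -- 1)` is the harmonic function of the upward walk, with value 1 at the lower barrier; it weighs
  -- the cost incurred if the test wrongly rejects.
  set φ : ℕ × ℕ → ℝ := fun w => if w.1 < n then
    (if χ w.1 then c * (a + b - w.2) + r ^ (w.2 + 1) * R (w.1 + 1)
      else c * (w.2 + 1) + R (w.1 + 1)) else 0 with hφ
  have hφR (j : ℕ) (hj : j ≤ n) : φ (j, a) ≤ R j := by
    have hj0 := hR0 j hj
    simp only [hφ]
    split_ifs with h1 h2
    · have h3 := hR0 (j + 1) h1
      have h4 := mul_le_mul_of_nonneg_right hr h3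
      have h5 : 2 * c * b ≤ R (j + 1) := by
        have : (0 : ℝ) ≤ n - (j + 1 : ℕ) := sub_nonneg.2 (by exact_mod_cast h1)
        have : 0 ≤ c * ((n - (j + 1 : ℕ)) * (a + 1)) := by positivity
        simp only [hR]; linarith
      have h6 : 0 ≤ c * ((a : ℝ) + 1) := by positivity
      have := hRs j
      linarith
    · exact (hRs j).ge
    · exact hj0
  have main := expect_run_sequentialTests_le p x z a b χ hχ 1 zero_le_one φ (fun _ => 0)
    ?_ ?_ ?_ ?_
  · rw [expectedQueries_eq]
    refine iSup_le fun t => le_trans ?_ ((main t).trans (ENNReal.ofReal_le_ofReal ?_))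
    · exact expect_mono _ fun c => by simp
    · refine (hφR 0 (Nat.zero_le n)).trans (le_of_eq ?_)
      simp [hR, hc]; ring
  · have hnn : ∀ i s, s ≤ a + b → 0 ≤ φ (i, s) := by
      intro i s hs
      simp only [hφ]
      have : (0 : ℝ) ≤ a + b - s := sub_nonneg.2 (by exact_mod_cast hs)
      split_ifs with h1 h2
      · have := hR0 (i + 1) h1
        positivity
      · have := hR0 (i + 1) h1
        positivity
      · exact le_rfl
    exact hnn
  · intro i s hi hs
    simp
  · intro i s hi
    simp [hφ, not_lt.2 hi]
  · intro i s hi hs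
    have h3 := hR0 (i + 1) hi
    have hdown := hφR (i + 1) hi
    have hs' : (0 : ℝ) ≤ a + b - s := sub_nonneg.2 (by exact_mod_cast hs.le)
    cases hxi : χ i
    · have hv (s) : φ (i, s) = c * (s + 1) + R (i + 1) := by simp [hφ, hi, hxi]
      cases s with
      | zero =>
        have h4 := mul_le_mul_of_nonneg_left hdown hq.le
        rw [Bool.not_false, nextState_true, nextState_false_zero, hv, hv]
        push_cast
        linarith
      | succ s =>
        rw [Bool.not_false, nextState_true, nextState_false_succ, hv, hv, hv]
        push_cast
        linarith
    · have hv (s) : φ (i, s) = c * (a + b - s) + r ^ (s + 1) * R (i + 1) := by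
        simp [hφ, hi, hxi]
      have hharm (s : ℕ) : (1 - p) * (r ^ (s + 2) * R (i + 1)) + p * (r ^ s * R (i + 1)) =
          r ^ (s + 1) * R (i + 1) := by
        rw [pow_add, pow_succ]
        linear_combination (r ^ s * R (i + 1) * (r - 1)) * hrq
      have h5 := hharm s
      cases s with
      | zero =>
        have h4 := mul_le_mul_of_nonneg_left hdown hp0.le
        -- At the lower barrier the linear part of the potential is simply discarded.
        have h6 : 0 ≤ p * (c * ((a : ℝ) + b + 1)) := by positivity
        rw [Bool.not_true, nextState_true, nextState_false_zero, hv, hv]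
        push_cast at h5 ⊢
        linarith
      | succ s =>
        rw [Bool.not_true, nextState_true, nextState_false_succ, hv, hv, hv]
        push_cast at h5 ⊢
        linarith

theorem errorProb_sequentialTests_of_forall_ne (hp0 : 0 < (p : ℝ)) (hp1 : (p : ℝ) < 1 / 2)
    (hr : ((p : ℝ) / (1 - p)) ^ (a + 1) ≤ 1 / 2) (hx : ∀ i, x i ≠ z) :
    errorProb p (sequentialTests n z a b) (existsBit z) x ≤
      ENNReal.ofReal (n * ((p : ℝ) / (1 - p)) ^ b) := by
  have hf : existsBit z x = !z := by simp [existsBit, hx]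
  have hq : 0 < 1 - (p : ℝ) := by linarith
  refine errorProb_le_of_expectedQueries p x _ _ ENNReal.ofReal_ne_top
    (expectedQueries_sequentialTests_le p x z a b hp0 hp1 hr) fun t => ?_
  rw [hf, Bool.not_not]
  set r : ℝ := p / (1 - p) with hrdef
  have hr0 : 0 < r := by positivity
  set ρ : ℝ := r⁻¹ with hρ
  have hρ0 : 0 < ρ := by positivity
  have hrq : ρ * p = 1 - p := by rw [hρ, hrdef]; field_simp
  have hrρ (m : ℕ) : r ^ m * ρ ^ m = 1 := by rw [← mul_pow, hρ, mul_inv_cancel₀ hr0.ne', one_pow]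
  have hρ1 : 1 ≤ ρ := by
    rw [hρ, hrdef, inv_div, le_div_iff₀ hp0]; linarith
  -- The first term is harmonic for the downward walk, equals 1 at the upper barrier and `r ^ b` at
  -- the start of a test; the second is a union bound over the bits not yet tested.
  set φ : ℕ × ℕ → ℝ := fun w => if w.1 < n then
    r ^ (a + b + 1) * ρ ^ (w.2 + 1) + (n - w.1 - 1) * r ^ b else 0 with hφ
  have hv (i s : ℕ) (hi : i < n) :
      φ (i, s) = r ^ (a + b + 1) * ρ ^ (s + 1) + (n - i - 1) * r ^ b := by simp [hφ, hi]
  have hni (i : ℕ) (hi : i < n) : (0 : ℝ) ≤ n - i - 1 := by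
    have : ((i + 1 : ℕ) : ℝ) ≤ n := by exact_mod_cast hi
    push_cast at this; linarith
  have hstart (i : ℕ) (hi : i ≤ n) : φ (i, a) ≤ (n - i) * r ^ b := by
    rcases hi.lt_or_eq with h | rfl
    · rw [hv _ _ h, show a + b + 1 = b + (a + 1) by ring, pow_add, mul_assoc, hrρ]
      linarith
    · simp [hφ]
  have main := expect_run_sequentialTests_le p x z a b (fun _ => false)
    (fun i => by simp [hx]) 0 le_rfl φ (fun y => if y = z then 1 else 0) ?_ ?_ ?_ ?_ t
  · refine le_trans ?_ (main.trans (ENNReal.ofReal_le_ofReal ?_))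
    · refine expect_mono _ fun c => ?_
      obtain ⟨h, _ | y⟩ := c
      · simp
      · by_cases hy : y = z <;> simp [hy]
    · simpa using hstart 0 (Nat.zero_le n)
  · intro i s hs
    simp only [hφ]
    split_ifs with hi
    · have := hni i hi
      positivity
    · exact le_rfl
  · intro i s hi hs
    refine ENNReal.ofReal_le_ofReal ?_
    have h1 : r ^ (a + b + 1) * ρ ^ (a + b + 1) ≤ r ^ (a + b + 1) * ρ ^ (s + 1) := by gcongr
    have h2 : 0 ≤ (n - i - 1) * r ^ b := mul_nonneg (hni i hi) (by positivity)
    rw [hrρ] at h1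
    rw [hv i s hi, if_pos rfl]
    linarith
  · intro i s hi
    simp [hφ, not_lt.2 hi]
  · intro i s hi hs
    have hharm (s : ℕ) : (1 - p) * ρ ^ s + p * ρ ^ (s + 2) = ρ ^ (s + 1) := by
      rw [pow_add, pow_succ]
      linear_combination (ρ ^ s * (ρ - 1)) * hrq
    have h5 : r ^ (a + b + 1) * _ = r ^ (a + b + 1) * _ := congrArg _ (hharm s)
    cases s with
    | zero =>
      have h4 := mul_le_mul_of_nonneg_left (hstart (i + 1) hi) hq.le
      have h6 : 0 ≤ (1 - (p : ℝ)) * r ^ (a + b + 1) := by positivity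
      rw [Bool.not_false, nextState_true, nextState_false_zero, hv _ _ hi, hv _ _ hi]
      push_cast at h4 h5 ⊢
      linarith
    | succ s =>
      rw [Bool.not_false, nextState_true, nextState_false_succ, hv _ _ hi, hv _ _ hi, hv _ _ hi]
      linarith

/-- Only the test of bit `m` matters: accepting any other bit gives the correct output, and
outputting `!z` requires bit `m` to be rejected. -/
theorem errorProb_sequentialTests_of_eq (hp0 : 0 < (p : ℝ)) (hp1 : (p : ℝ) < 1 / 2)
    (hr : ((p : ℝ) / (1 - p)) ^ (a + 1) ≤ 1 / 2) (m : Fin n) (hx : x m = z) :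
    errorProb p (sequentialTests n z a b) (existsBit z) x ≤
      ENNReal.ofReal (((p : ℝ) / (1 - p)) ^ (a + 1)) := by
  have hf : existsBit z x = z := by
    have : ∃ i, x i = z := ⟨m, hx⟩
    simp only [existsBit, if_pos this]
  have hq : 0 < 1 - (p : ℝ) := by linarith
  refine errorProb_le_of_expectedQueries p x _ _ ENNReal.ofReal_ne_top
    (expectedQueries_sequentialTests_le p x z a b hp0 hp1 hr) fun t => ?_
  rw [hf]
  obtain ⟨χ, hχ⟩ := exists_matches x z
  have hχm : χ m = true := by rw [hχ, hx]; simp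
  set r : ℝ := p / (1 - p) with hrdef
  have hr0 : 0 < r := by positivity
  have hrq : r * (1 - p) = p := by rw [hrdef]; field_simp
  -- The ruin bound for the test of bit `m`: its starting value before that test, and the trivial
  -- bound 1 once the bit has been rejected.
  set φ : ℕ × ℕ → ℝ := fun w => if w.1 < m then r ^ (a + 1) else
    if w.1 = m then r ^ (w.2 + 1) else 1 with hφ
  have hlt (i s : ℕ) (hi : i < m) : φ (i, s) = r ^ (a + 1) := by simp [hφ, hi]
  have heq (s : ℕ) : φ (m, s) = r ^ (s + 1) := by simp [hφ]
  have hgt (i s : ℕ) (hi : (m : ℕ) < i) : φ (i, s) = 1 := by simp [hφ, hi.not_gt, hi.ne']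
  have hstart (i : ℕ) (hi : i ≤ m) : φ (i, a) = r ^ (a + 1) := by
    rcases hi.lt_or_eq with h | rfl
    · exact hlt _ _ h
    · exact heq a
  have main := expect_run_sequentialTests_le p x z a b χ hχ 0 le_rfl φ
    (fun y => if y = z then 0 else 1) ?_ ?_ ?_ ?_ t
  · rw [hstart 0 (Nat.zero_le _)] at main
    refine le_trans ?_ main
    refine expect_mono _ fun c => ?_
    obtain ⟨h, _ | y⟩ := c
    · simp
    · by_cases hy : y = z
      · simp [hy]
      · simp only [if_neg hy, Option.elim]; split_ifs <;> simp
  · intro i s hs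
    simp only [hφ]
    split_ifs <;> positivity
  · intro i s hi hs
    simp
  · intro i s hi
    rw [hgt i s (m.2.trans_le hi)]
    simp
  · intro i s hi hs
    rcases lt_trichotomy i m with h | rfl | h
    · have hn (up : Bool) : φ (nextState a up (i, s)) = r ^ (a + 1) := by
        cases up
        · cases s with
          | zero => exact hstart _ h
          | succ s => exact hlt _ _ h
        · exact hlt _ _ h
      rw [hn, hn, hlt _ _ h]
      linarith
    · have hdown : φ (nextState a false (m, s)) = r ^ s := by
        cases s with
        | zero => rw [nextState_false_zero, hgt _ _ (Nat.lt_succ_self _), pow_zero]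
        | succ s => exact heq s
      rw [hχm, Bool.not_true, hdown, nextState_true, heq, heq, pow_succ, pow_succ]
      refine le_of_eq ?_
      linear_combination (r ^ s * (r - 1)) * hrq
    · have hn (up : Bool) : φ (nextState a up (i, s)) = 1 := by
        cases up
        · cases s with
          | zero => exact hgt _ _ (by omega)
          | succ s => exact hgt _ _ h
        · exact hgt _ _ h
      rw [hn, hn, hgt _ _ h]
      linarith

theorem worstCaseError_sequentialTests_le (hp0 : 0 < (p : ℝ)) (hp1 : (p : ℝ) < 1 / 2) {d : ℝ}
    (hd : d ≤ 1 / 2) (ha : ((p : ℝ) / (1 - p)) ^ (a + 1) ≤ d)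
    (hb : n * ((p : ℝ) / (1 - p)) ^ b ≤ d) :
    worstCaseError p (sequentialTests n z a b) (existsBit z) ≤ ENNReal.ofReal d := by
  rw [worstCaseError_le_iff]
  intro x
  by_cases h : ∃ m, x m = z
  · obtain ⟨m, hm⟩ := h
    exact (errorProb_sequentialTests_of_eq p x z a b hp0 hp1 (ha.trans hd) m hm).trans
      (ENNReal.ofReal_le_ofReal ha)
  · exact (errorProb_sequentialTests_of_forall_ne p x z a b hp0 hp1 (ha.trans hd)
      (not_exists.1 h)).trans (ENNReal.ofReal_le_ofReal hb)

end upper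
-- Choice of the barriers and the asymptotic statement.
/-- The sequential tests with suitable barriers are asymptotically optimal. -/
theorem exists_algorithm_le {n : ℕ} (p : unitInterval) (hp0 : 0 < (p : ℝ)) (hp1 : (p : ℝ) < 1 / 2)
    (z : Bool) (hn : 0 < n) {d : ℝ} (hd0 : 0 < d) (hd : d ≤ 1 / 2) :
    ∃ A : Algorithm n, worstCaseError p A (existsBit z) ≤ ENNReal.ofReal d ∧
      ∀ x, expectedQueries p A x ≤ ENNReal.ofReal
        ((n * (Real.log (1 / d) + Real.log ((1 - p) / p)) +
          2 * (Real.log (1 / d) + Real.log n + Real.log ((1 - p) / p))) / klBern p) := by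
  have hq : 0 < 1 - (p : ℝ) := by linarith
  have hq2 : 0 < 1 - 2 * (p : ℝ) := by linarith
  have hn' : (0 : ℝ) < n := by exact_mod_cast hn
  have hL : 0 < Real.log ((1 - p) / p) := by
    refine Real.log_pos ?_
    rw [lt_div_iff₀ hp0]; linarith
  have hl : 0 ≤ Real.log (1 / d) := Real.log_nonneg (by rw [le_div_iff₀ hd0]; linarith)
  have hlogn : 0 ≤ Real.log n := Real.log_nonneg (by exact_mod_cast hn)
  have hrL : (p : ℝ) / (1 - p) = Real.exp (-Real.log ((1 - p) / p)) := by
    rw [Real.exp_neg, Real.exp_log (by positivity), inv_div]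
  have hdl : d = Real.exp (-Real.log (1 / d)) := by
    rw [one_div, Real.log_inv, neg_neg, Real.exp_log hd0]
  rw [klBern_eq p hp0 hp1]
  set L := Real.log ((1 - p) / p)
  set l := Real.log (1 / d)
  -- The smallest descent `a + 1` exceeding `l / L` gives `r ^ (a + 1) ≤ d` for `r = p / (1 - p)`;
  -- `b` is the least height with `n * r ^ b ≤ d`. Rounding adds at most one step to each.
  set a := ⌊l / L⌋₊
  set b := ⌈(l + Real.log n) / L⌉₊
  have ha1 : l ≤ L * (a + 1) := by
    have := (Nat.lt_floor_add_one (l / L)).le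
    rwa [div_le_iff₀' hL] at this
  have ha2 : (a + 1 : ℝ) ≤ (l + L) / L := by
    rw [add_div, div_self hL.ne']
    have := Nat.floor_le (a := l / L) (by positivity)
    linarith
  have hb1 : l + Real.log n ≤ L * b := by
    have := Nat.le_ceil ((l + Real.log n) / L)
    rwa [div_le_iff₀' hL] at this
  have hb2 : (b : ℝ) ≤ (l + Real.log n + L) / L := by
    rw [add_div _ L, div_self hL.ne']
    exact (Nat.ceil_lt_add_one (by positivity)).le
  have ha : ((p : ℝ) / (1 - p)) ^ (a + 1) ≤ d := by
    rw [hrL, hdl, ← Real.exp_nat_mul, Real.exp_le_exp]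
    push_cast; linarith
  have hb : n * ((p : ℝ) / (1 - p)) ^ b ≤ d := by
    rw [hrL, hdl, ← Real.exp_nat_mul]
    nth_rw 1 [← Real.exp_log hn']
    rw [← Real.exp_add, Real.exp_le_exp]
    linarith
  refine ⟨sequentialTests n z a b, worstCaseError_sequentialTests_le p z a b hp0 hp1 hd ha hb,
    fun x => (expectedQueries_sequentialTests_le p x z a b hp0 hp1 (ha.trans hd)).trans
      (ENNReal.ofReal_le_ofReal ?_)⟩
  calc (n * (a + 1) + 2 * b) / (1 - 2 * (p : ℝ))
      ≤ (n * ((l + L) / L) + 2 * ((l + Real.log n + L) / L)) / (1 - 2 * p) := by gcongr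
    _ = _ := by field_simp

end NoisyQuery

theorem corollary1 (p : unitInterval) (hp0 : 0 < (p : ℝ)) (hp1 : (p : ℝ) < 1 / 2)
    (δ : ℕ → ℝ) (hδpos : ∀ n, 0 < δ n) (hδ : Tendsto δ atTop (𝓝 0)) :
    ∃ ε : ℕ → ℝ, Tendsto ε atTop (𝓝 0) ∧
      ∀ᶠ n : ℕ in atTop,
        ∀ f : (Fin n → Bool) → Bool, f = NoisyQuery.orFn ∨ f = NoisyQuery.andFn →
          (∀ A : NoisyQuery.Algorithm n,
            (∀ x : Fin n → Bool, NoisyQuery.expectedQueries p A x ≤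
              ENNReal.ofReal
                ((1 - ε n) * ((n : ℝ) * Real.log (1 / δ n) / NoisyQuery.klBern p))) →
            ENNReal.ofReal (δ n) < NoisyQuery.worstCaseError p A f) ∧
          (∃ A : NoisyQuery.Algorithm n,
            NoisyQuery.worstCaseError p A f ≤ ENNReal.ofReal (δ n) ∧
            ∀ x : Fin n → Bool, NoisyQuery.expectedQueries p A x ≤
              ENNReal.ofReal
                ((1 + ε n) * ((n : ℝ) * Real.log (1 / δ n) / NoisyQuery.klBern p))) := by
  have hL : 0 < Real.log ((1 - p) / p) := by
    refine Real.log_pos ?_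
    rw [lt_div_iff₀ hp0]; linarith
  have hD : 0 < NoisyQuery.klBern p := by
    rw [NoisyQuery.klBern_eq p hp0 hp1]
    exact mul_pos (by linarith) hL
  set L := Real.log ((1 - p) / p)
  have hl : Tendsto (fun n => Real.log (1 / δ n)) atTop atTop := by
    simp only [one_div]
    exact Real.tendsto_log_atTop.comp (tendsto_inv_nhdsGT_zero.comp
      (tendsto_nhdsWithin_iff.2 ⟨hδ, Eventually.of_forall hδpos⟩))
  have hl' := tendsto_inv_atTop_zero.comp hl
  have hn' : Tendsto (fun n : ℕ => (n : ℝ)⁻¹) atTop (𝓝 0) := tendsto_inv_atTop_nhds_zero_nat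
  have hlogn : Tendsto (fun n : ℕ => Real.log n / n) atTop (𝓝 0) := by
    simpa [Function.comp_def] using (Real.tendsto_pow_log_div_mul_add_atTop 1 0 1 one_ne_zero).comp
      tendsto_natCast_atTop_atTop
  -- The terms `2δ + 1 / l` absorb the loss in the lower bound, using `log 2 < 1`; the others are
  -- exactly the excess of the sequential tests' cost over `n l`, divided by `n l`.
  set ε : ℕ → ℝ := fun n => 2 * δ n + (1 + L) * (Real.log (1 / δ n))⁻¹ + 2 * (n : ℝ)⁻¹ +
    2 * (Real.log n / n) * (Real.log (1 / δ n))⁻¹ +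
    2 * L * (n : ℝ)⁻¹ * (Real.log (1 / δ n))⁻¹ with hε
  have hε0 : Tendsto ε atTop (𝓝 0) := by
    have := ((((hδ.const_mul 2).add (hl'.const_mul (1 + L))).add (hn'.const_mul 2)).add
      ((hlogn.const_mul 2).mul hl')).add ((hn'.const_mul (2 * L)).mul hl')
    simp only [mul_zero, add_zero] at this
    exact this
  refine ⟨ε, hε0, ?_⟩
  -- The condition `ε n ≤ 1` keeps the query budget in the necessity part nonnegative.
  filter_upwards [hε0.eventually_le_const one_pos, hδ.eventually_le_const (half_pos one_pos),
    hl.eventually_gt_atTop 0, eventually_gt_atTop 0] with n hε1 hδ1 hl0 hn0 f hf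
  obtain ⟨z, rfl⟩ : ∃ z, f = NoisyQuery.existsBit z := by
    rcases hf with rfl | rfl
    · exact ⟨true, NoisyQuery.orFn_eq⟩
    · exact ⟨false, NoisyQuery.andFn_eq⟩
  have hnR : (0 : ℝ) < n := by exact_mod_cast hn0
  have hlogn0 : 0 ≤ Real.log n := Real.log_nonneg (by exact_mod_cast hn0)
  have hd0 := hδpos n
  set l := Real.log (1 / δ n) with hldef
  have hεn : ε n = 2 * δ n + (1 + L) * l⁻¹ + 2 * (n : ℝ)⁻¹ + 2 * (Real.log n / n) * l⁻¹ +
    2 * L * (n : ℝ)⁻¹ * l⁻¹ := rfl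
  constructor
  · intro A hA
    by_contra! herr
    have h1 := NoisyQuery.le_of_worstCaseError_le p A hp0 hp1 z hd0 (by linarith)
      (mul_nonneg (sub_nonneg.2 hε1) (by positivity)) herr hA
    rw [← hldef, show NoisyQuery.klBern p * ((1 - ε n) * (n * l / NoisyQuery.klBern p)) =
      n * ((1 - ε n) * l) by field_simp] at h1
    have h2 := le_of_mul_le_mul_left h1 hnR
    have h3 : 2 * δ n * l + 1 ≤ ε n * l := by
      have h4 : 2 * δ n + l⁻¹ ≤ ε n := by
        have h5 : 0 ≤ L * l⁻¹ + 2 * (n : ℝ)⁻¹ + 2 * (Real.log n / n) * l⁻¹ +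
          2 * L * (n : ℝ)⁻¹ * l⁻¹ := by positivity
        rw [hεn]; linarith
      have h6 := mul_le_mul_of_nonneg_right h4 hl0.le
      rwa [add_mul, inv_mul_cancel₀ hl0.ne'] at h6
    linarith [Real.log_two_lt_d9]
  · obtain ⟨A, hA, hM⟩ := NoisyQuery.exists_algorithm_le p hp0 hp1 z hn0 hd0 (by linarith)
    refine ⟨A, hA, fun x => (hM x).trans (ENNReal.ofReal_le_ofReal ?_)⟩
    rw [← hldef, ← mul_div_assoc]
    gcongr
    have h1 : (1 + ε n) * (n * l) = n * (l + L) + 2 * (l + Real.log n + L) +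
        (2 * δ n + l⁻¹) * (n * l) := by
      rw [hεn]; field_simp; ring
    have h2 : 0 ≤ (2 * δ n + l⁻¹) * (n * l) := by positivity
    rw [h1]
    linarith
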